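/- Let $d_A,d_B\ge 1$ be integers and let $\mathcal M_d$ denote the complex $d\times d$ matrices. Regard $M\in\mathcal M_{d_A\otimes d_B}:=\mathcal M_{d_A}\otimes\mathcal M_{d_B}$ as a $d_A\times d_A$ block matrix $M=[M_{ij}]$ with blocks $M_{ij}\in\mathcal M_{d_B}$. Its partial traces are $\mathrm{tr}_B[M]:=\big(\mathrm{tr}\,M_{ij}\big)_{i,j}\in\mathcal M_{d_A}$ and $\mathrm{tr}_A[M]:=\sum_{i=1}^{d_A}M_{ii}\in\mathcal M_{d_B}$. Two complex square matrices $A$ and $B$, possibly of different sizes, are called Flanders-similar if they have the same Jordan blocks (counted with multiplicity) for all non-zero eigenvalues and if, in addition, $|a_i-b_i|\le 1$ for all $i$, where $a_1\ge a_2\ge\dots$ and $b_1\ge b_2\ge\dots$ are the sizes of the Jordan blocks with eigenvalue $0$ of $A$ and of $B$, respectively, both sequences being padded with zeros. (i) Let $A\in\mathcal M_{d_A}$ and $B\in\mathcal M_{d_B}$ be Flanders-similar, and exclude the degenerate case in which $A=0$, $B=0$ and $\min(d_A,d_B)=1$. Then there is a matrix $M\in\mathcal M_{d_A\otimes d_B}$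 of rank one such that $\mathrm{tr}_A[M]=B$ and $\mathrm{tr}_B[M]=A$. (ii) Let $A\in\mathcal M_{d_A}$ have rank $r$, and exclude the degenerate case in which $A=0$ and $d_B=1$. Then there is a matrix $M\in\mathcal M_{d_A\otimes d_B}$ of rank one such that $A=\mathrm{tr}_B[M]$ if and only if $d_B\ge r$. -/

import Mathlib

namespace PartialTrace

/-- The partial trace `tr_B`: regarding `M` as a block matrix `[M i j]` with blocks indexed by `n`,
its `(i, j)` entry is the trace of the block `M i j`. -/
def trB {m n : Type*} [Fintype n] (M : Matrix (m × n) (m × n) ℂ) : Matrix m m ℂ :=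
  Matrix.of fun i j => ∑ k, M (i, k) (j, k)

/-- The partial trace `tr_A`: the sum of the diagonal blocks of `M`. -/
def trA {m n : Type*} [Fintype m] (M : Matrix (m × n) (m × n) ℂ) : Matrix n n ℂ :=
  Matrix.of fun k l => ∑ i, M (i, k) (i, l)

/-- The Jordan block of size `s` with eigenvalue `μ`: `μ` on the diagonal, `1` on the first
superdiagonal, `0` elsewhere. -/
noncomputable def jordanBlock (μ : ℂ) (s : ℕ) : Matrix (Fin s) (Fin s) ℂ :=
  Matrix.of fun i j => if i = j then μ else if i.val + 1 = j.val then 1 else 0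

/-- The block diagonal matrix whose diagonal blocks are the Jordan blocks listed in `L`
(pairs: eigenvalue, size). -/
noncomputable def jordanMatrix (L : List (ℂ × ℕ)) :
    Matrix ((k : Fin L.length) × Fin (L.get k).2) ((k : Fin L.length) × Fin (L.get k).2) ℂ :=
  Matrix.blockDiagonal' fun k => jordanBlock (L.get k).1 (L.get k).2

/-- `L` lists the Jordan blocks (eigenvalue, size) of `A`, in some order: all sizes are positive and
`A = P J P⁻¹`, where `J` is the block diagonal matrix of these blocks and `P⁻¹` is written `Q`. -/
def IsJordanBlockList {n : Type*} [Fintype n] [DecidableEq n] (A : Matrix n n ℂ)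
    (L : List (ℂ × ℕ)) : Prop :=
  (∀ b ∈ L, 0 < b.2) ∧
    ∃ (P : Matrix n ((k : Fin L.length) × Fin (L.get k).2) ℂ)
      (Q : Matrix ((k : Fin L.length) × Fin (L.get k).2) n ℂ),
      P * Q = 1 ∧ Q * P = 1 ∧ A = P * jordanMatrix L * Q

/-- The Segre characteristic at `0`: the sizes of the blocks with eigenvalue `0` in nonincreasing
order (indexed from `0`), padded with zeros. -/
noncomputable def segreAtZero (L : List (ℂ × ℕ)) (i : ℕ) : ℕ :=
  (((L.filter fun b => b.1 = 0).map Prod.snd).insertionSort (· ≥ ·)).getD i 0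

/-- Flanders-similarity of two complex square matrices, possibly of different sizes: they have the
same Jordan blocks (with multiplicity) at all nonzero eigenvalues, and their Segre characteristics
at `0` differ by at most one in every place. The list of Jordan blocks of a complex matrix exists
and is unique up to order, and the condition does not depend on the order. -/
def FlandersSimilar {m n : Type*} [Fintype m] [DecidableEq m] [Fintype n] [DecidableEq n]
    (A : Matrix m m ℂ) (B : Matrix n n ℂ) : Prop :=
  ∃ LA LB : List (ℂ × ℕ), IsJordanBlockList A LA ∧ IsJordanBlockList B LB ∧
    (LA.filter fun b => b.1 ≠ 0).Perm (LB.filter fun b => b.1 ≠ 0) ∧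
    ∀ i : ℕ, |(segreAtZero LA i : ℤ) - (segreAtZero LB i : ℤ)| ≤ 1

end PartialTrace

namespace PartialTrace

/-! A rank-one `M` is `vecMulVec x y`. Reshaping `x` and `y` into an `m × n` matrix `X` and an `n ×
m` matrix `Z` turns `tr_B M` into `X * Z` and `tr_A M` into `Xᵀ * Zᵀ = (Z * X)ᵀ`. So (ii) is rank
factorization (`rank_le_iff_exists_mul`), and (i) is the constructive half of Flanders' theorem on
the pairs `X * Z`, `Z * X`. Such pairs are stable under similarity of either member and under direct
sums, which reduces (i) to single Jordan blocks: a block pairs with itself, and nilpotent blocks of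
sizes `s + 1` and `s` pair through truncated shifts. The transpose is harmless because a Jordan
block is similar to its transpose. A nonzero partial trace forces `X` and `Z` to be nonzero, hence
rank exactly one; zero targets are met with matrix units. -/

open Matrix

/-! ### Rank factorization -/

section RankFactorization

/-- A matrix has rank at most the number `k` iff it factors through a `k`-dimensional space. -/
theorem rank_le_iff_exists_mul {K m n : Type*} [Field K] [Fintype m] [Fintype n] (A : Matrix m n K)
    (k : ℕ) :
    A.rank ≤ k ↔ ∃ (X : Matrix m (Fin k) K) (Z : Matrix (Fin k) n K), X * Z = A := by
  classical
  constructor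
  · intro h
    have h' : Module.finrank K (LinearMap.range A.mulVecLin) ≤ Module.finrank K (Fin k → K) := by
      simpa [Matrix.rank] using h
    obtain ⟨f, hf⟩ := finrank_le_iff_exists_linearMap.mp h'
    obtain ⟨g, hg⟩ := f.exists_leftInverse_of_injective (LinearMap.ker_eq_bot.mpr hf)
    -- `f` embeds the range of `A` into `K ^ k` and `g` retracts it, so `A` factors as (inclusion ∘
    -- `g`) ∘ (`f` ∘ `A`).
    refine ⟨LinearMap.toMatrix' ((LinearMap.range A.mulVecLin).subtype ∘ₗ g),
      LinearMap.toMatrix' (f ∘ₗ A.mulVecLin.rangeRestrict), ?_⟩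
    rw [← LinearMap.toMatrix'_comp, LinearMap.comp_assoc, ← LinearMap.comp_assoc _ f g, hg,
      LinearMap.id_comp, LinearMap.subtype_comp_codRestrict]
    exact LinearMap.toMatrix'_toLin' A
  · rintro ⟨X, Z, rfl⟩
    exact (rank_mul_le_left X Z).trans (X.rank_le_card_width.trans_eq (Fintype.card_fin k))

theorem rank_vecMulVec_eq_one {K m n : Type*} [Field K] [Fintype m] [Fintype n] {x : m → K}
    {y : n → K} (hx : x ≠ 0) (hy : y ≠ 0) : (vecMulVec x y).rank = 1 := by
  refine le_antisymm (rank_vecMulVec_le x y) (Nat.one_le_iff_ne_zero.mpr fun h => ?_)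
  obtain ⟨X, Z, hXZ⟩ := (rank_le_iff_exists_mul _ 0).mp h.le
  obtain ⟨i, hi⟩ := Function.ne_iff.mp hx
  obtain ⟨j, hj⟩ := Function.ne_iff.mp hy
  have h0 := congrFun (congrFun hXZ i) j
  simp only [mul_apply, Finset.univ_eq_empty, Finset.sum_empty, vecMulVec_apply] at h0
  exact mul_ne_zero hi hj h0.symm

end RankFactorization

/-! ### Similarity across index types -/

section Similarity

/-- Similarity of square matrices with possibly different index types. -/
def IsSimilar {m n : Type*} [Fintype m] [DecidableEq m] [Fintype n] [DecidableEq n]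
    (A : Matrix m m ℂ) (B : Matrix n n ℂ) : Prop :=
  ∃ (P : Matrix m n ℂ) (Q : Matrix n m ℂ), P * Q = 1 ∧ Q * P = 1 ∧ A = P * B * Q

variable {m n o p : Type*} [Fintype m] [DecidableEq m] [Fintype n] [DecidableEq n]
  [Fintype o] [DecidableEq o] [Fintype p] [DecidableEq p]

theorem IsSimilar.refl (A : Matrix m m ℂ) : IsSimilar A A := ⟨1, 1, by simp⟩

theorem IsSimilar.symm {A : Matrix m m ℂ} {B : Matrix n n ℂ} (h : IsSimilar A B) :
    IsSimilar B A := by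
  obtain ⟨P, Q, hPQ, hQP, rfl⟩ := h
  refine ⟨Q, P, hQP, hPQ, ?_⟩
  calc B = (Q * P) * B * (Q * P) := by simp [hQP]
    _ = Q * (P * B * Q) * P := by simp only [Matrix.mul_assoc]

theorem IsSimilar.trans {A : Matrix m m ℂ} {B : Matrix n n ℂ} {C : Matrix o o ℂ}
    (h : IsSimilar A B) (h' : IsSimilar B C) : IsSimilar A C := by
  obtain ⟨P, Q, hPQ, hQP, rfl⟩ := h
  obtain ⟨R, S, hRS, hSR, rfl⟩ := h'
  refine ⟨P * R, S * Q, ?_, ?_, by simp only [Matrix.mul_assoc]⟩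
  · calc P * R * (S * Q) = P * (R * S) * Q := by simp only [Matrix.mul_assoc]
      _ = 1 := by rw [hRS, Matrix.mul_one, hPQ]
  · calc S * Q * (P * R) = S * (Q * P) * R := by simp only [Matrix.mul_assoc]
      _ = 1 := by rw [hQP, Matrix.mul_one, hSR]

theorem isSimilar_submatrix (A : Matrix m m ℂ) (e : n ≃ m) : IsSimilar (A.submatrix e e) A := by
  refine ⟨(1 : Matrix m m ℂ).submatrix e id, (1 : Matrix m m ℂ).submatrix id e, ?_, ?_, ?_⟩
  · ext i j
    simp [mul_apply, one_apply]
  · ext i j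
    rw [mul_apply]
    refine (e.sum_comp (fun x => (1 : Matrix m m ℂ) i x * (1 : Matrix m m ℂ) x j)).trans ?_
    rw [← mul_apply, Matrix.one_mul]
  · ext i j
    simp [mul_apply, one_apply]

theorem IsSimilar.fromBlocks {A : Matrix m m ℂ} {B : Matrix n n ℂ} {C : Matrix o o ℂ}
    {D : Matrix p p ℂ} (h : IsSimilar A B) (h' : IsSimilar C D) :
    IsSimilar (fromBlocks A 0 0 C) (fromBlocks B 0 0 D) := by
  obtain ⟨P, Q, hPQ, hQP, rfl⟩ := h
  obtain ⟨R, S, hRS, hSR, rfl⟩ := h'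
  exact ⟨Matrix.fromBlocks P 0 0 R, Matrix.fromBlocks Q 0 0 S, by simp [fromBlocks_multiply, *],
    by simp [fromBlocks_multiply, *], by simp [fromBlocks_multiply]⟩

theorem isSimilar_fromBlocks_comm (A : Matrix m m ℂ) (B : Matrix n n ℂ) :
    IsSimilar (fromBlocks A 0 0 B) (fromBlocks B 0 0 A) := by
  convert isSimilar_submatrix (fromBlocks B 0 0 A) (Equiv.sumComm m n) using 1
  ext (i | i) (j | j) <;> simp

theorem isSimilar_fromBlocks_assoc (A : Matrix m m ℂ) (B : Matrix n n ℂ) (C : Matrix o o ℂ) :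
    IsSimilar (fromBlocks (fromBlocks A 0 0 B) 0 0 C) (fromBlocks A 0 0 (fromBlocks B 0 0 C)) := by
  convert isSimilar_submatrix (fromBlocks A 0 0 (fromBlocks B 0 0 C)) (Equiv.sumAssoc m n o) using 1
  ext ((i | i) | i) ((j | j) | j) <;> simp

theorem isSimilar_fromBlocks_of_isEmpty [IsEmpty m] (A : Matrix m m ℂ) (B : Matrix n n ℂ) :
    IsSimilar (fromBlocks A 0 0 B) B := by
  convert isSimilar_submatrix B (Equiv.emptySum m n) using 1
  ext (i | i) (j | j)
  · exact isEmptyElim i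
  · exact isEmptyElim i
  · exact isEmptyElim j
  · simp

end Similarity

/-! ### Jordan matrices as direct sums -/

section JordanMatrix

theorem isSimilar_jordanMatrix_cons (a : ℂ × ℕ) (L : List (ℂ × ℕ)) :
    IsSimilar (jordanMatrix (a :: L)) (fromBlocks (jordanBlock a.1 a.2) 0 0 (jordanMatrix L)) := by
  let f : Fin a.2 ⊕ ((k : Fin L.length) × Fin (L.get k).2) →
      ((k : Fin (a :: L).length) × Fin ((a :: L).get k).2) :=
    Sum.elim (fun x => ⟨0, x⟩) (fun q => ⟨q.1.succ, q.2⟩)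
  have hf : Function.Bijective f := by
    constructor
    · rintro (x | ⟨k, x⟩) (y | ⟨l, y⟩) h
      · exact congrArg Sum.inl (eq_of_heq (Sigma.mk.inj h).2)
      · exact absurd (congrArg (fun q => q.1.val) h) (by simp [f])
      · exact absurd (congrArg (fun q => q.1.val) h) (by simp [f])
      · obtain rfl : k = l := Fin.succ_injective _ (congrArg Sigma.fst h)
        obtain rfl : x = y := eq_of_heq (Sigma.mk.inj h).2
        rfl
    · rintro ⟨k, x⟩
      induction k using Fin.cases with
      | zero => exact ⟨Sum.inl x, rfl⟩
      | succ k => exact ⟨Sum.inr ⟨k, x⟩, rfl⟩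
  convert (isSimilar_submatrix (jordanMatrix (a :: L)) (Equiv.ofBijective f hf)).symm using 1
  ext (x | ⟨k, x⟩) (y | ⟨l, y⟩)
  · exact (blockDiagonal'_apply_eq (fun k => jordanBlock ((a :: L).get k).1 ((a :: L).get k).2)
      0 x y).symm
  · exact (blockDiagonal'_apply_ne (fun k => jordanBlock ((a :: L).get k).1 ((a :: L).get k).2)
      (k := 0) (k' := l.succ) x y (Fin.succ_ne_zero l).symm).symm
  · exact (blockDiagonal'_apply_ne (fun k => jordanBlock ((a :: L).get k).1 ((a :: L).get k).2)
      (k := k.succ) (k' := 0) x y (Fin.succ_ne_zero k)).symm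
  · by_cases h : k = l
    · subst h
      exact (blockDiagonal'_apply_eq (fun k => jordanBlock (L.get k).1 (L.get k).2) k x y).trans
        (blockDiagonal'_apply_eq (fun k => jordanBlock ((a :: L).get k).1 ((a :: L).get k).2)
          k.succ x y).symm
    · exact (blockDiagonal'_apply_ne (fun k => jordanBlock (L.get k).1 (L.get k).2) x y h).trans
        (blockDiagonal'_apply_ne (fun k => jordanBlock ((a :: L).get k).1 ((a :: L).get k).2)
          (k := k.succ) (k' := l.succ) x y (fun h' => h (Fin.succ_injective _ h'))).symm

theorem isSimilar_jordanMatrix_append (L L' : List (ℂ × ℕ)) :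
    IsSimilar (jordanMatrix (L ++ L')) (fromBlocks (jordanMatrix L) 0 0 (jordanMatrix L')) := by
  induction L with
  | nil =>
    have : IsEmpty ((k : Fin ([] : List (ℂ × ℕ)).length) × Fin (([] : List (ℂ × ℕ)).get k).2) :=
      ⟨fun q => q.1.elim0⟩
    exact (isSimilar_fromBlocks_of_isEmpty _ _).symm
  | cons a L ih =>
    exact ((isSimilar_jordanMatrix_cons a (L ++ L')).trans ((IsSimilar.refl _).fromBlocks ih)).trans
      ((isSimilar_fromBlocks_assoc _ _ _).symm.trans
        ((isSimilar_jordanMatrix_cons a L).symm.fromBlocks (IsSimilar.refl _)))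

theorem isSimilar_jordanMatrix_of_perm {L L' : List (ℂ × ℕ)} (h : L.Perm L') :
    IsSimilar (jordanMatrix L) (jordanMatrix L') := by
  induction h with
  | nil => exact .refl _
  | cons a _ ih =>
    exact ((isSimilar_jordanMatrix_cons a _).trans ((IsSimilar.refl _).fromBlocks ih)).trans
      (isSimilar_jordanMatrix_cons a _).symm
  | swap a b L =>
    have key : ∀ c d : ℂ × ℕ, IsSimilar (jordanMatrix (c :: d :: L))
        (fromBlocks (fromBlocks (jordanBlock c.1 c.2) 0 0 (jordanBlock d.1 d.2)) 0 0
          (jordanMatrix L)) := fun c d =>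
      ((isSimilar_jordanMatrix_cons c _).trans
        ((IsSimilar.refl _).fromBlocks (isSimilar_jordanMatrix_cons d L))).trans
        (isSimilar_fromBlocks_assoc _ _ _).symm
    exact (key b a).trans
      (((isSimilar_fromBlocks_comm _ _).fromBlocks (IsSimilar.refl _)).trans (key a b).symm)
  | trans _ _ ih ih' => exact ih.trans ih'

end JordanMatrix

/-! ### Pairs of partial traces and Flanders' construction -/

section TracePair

/-- `A` and `B` are the two partial traces of `vecMulVec x y`, where `x` and `y` are the entries of
`X` and of `Zᵀ`. -/
def IsTracePair {m n : Type*} [Fintype m] [Fintype n] (A : Matrix m m ℂ) (B : Matrix n n ℂ) :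
    Prop :=
  ∃ (X : Matrix m n ℂ) (Z : Matrix n m ℂ), X * Z = A ∧ Xᵀ * Zᵀ = B

variable {m n o p : Type*} [Fintype m] [Fintype n] [Fintype o] [Fintype p]

theorem IsTracePair.symm {A : Matrix m m ℂ} {B : Matrix n n ℂ} (h : IsTracePair A B) :
    IsTracePair B A := by
  obtain ⟨X, Z, hA, hB⟩ := h
  exact ⟨Xᵀ, Zᵀ, hB, by simpa using hA⟩

/-- Passing to `P * X` and `Z * Q` conjugates `X * Z`, while `Z * Q * P * X = Z * X` is unchanged.
-/
theorem IsTracePair.of_isSimilar_left [DecidableEq m] [DecidableEq o] {A : Matrix m m ℂ}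
    {A' : Matrix o o ℂ} {B : Matrix n n ℂ} (h : IsTracePair A B) (hA : IsSimilar A' A) :
    IsTracePair A' B := by
  obtain ⟨X, Z, rfl, rfl⟩ := h
  obtain ⟨P, Q, hPQ, hQP, rfl⟩ := hA
  refine ⟨P * X, Z * Q, by simp only [Matrix.mul_assoc], ?_⟩
  calc (P * X)ᵀ * (Z * Q)ᵀ = Xᵀ * (Q * P)ᵀ * Zᵀ := by
        simp only [transpose_mul, Matrix.mul_assoc]
    _ = Xᵀ * Zᵀ := by simp [hQP]

theorem IsTracePair.of_isSimilar_right [DecidableEq n] [DecidableEq o] {A : Matrix m m ℂ}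
    {B : Matrix n n ℂ} {B' : Matrix o o ℂ} (h : IsTracePair A B) (hB : IsSimilar B' B) :
    IsTracePair A B' :=
  (h.symm.of_isSimilar_left hB).symm

theorem IsTracePair.fromBlocks {A : Matrix m m ℂ} {B : Matrix n n ℂ} {C : Matrix o o ℂ}
    {D : Matrix p p ℂ} (h : IsTracePair A B) (h' : IsTracePair C D) :
    IsTracePair (fromBlocks A 0 0 C) (fromBlocks B 0 0 D) := by
  obtain ⟨X, Z, rfl, rfl⟩ := h
  obtain ⟨X', Z', rfl, rfl⟩ := h'
  exact ⟨Matrix.fromBlocks X 0 0 X', Matrix.fromBlocks Z 0 0 Z', by simp [fromBlocks_multiply],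
    by simp [fromBlocks_multiply, fromBlocks_transpose]⟩

/-- Reversing the basis makes a Jordan block similar to its transpose; this absorbs the transposes
in `IsTracePair`. -/
theorem jordanBlock_submatrix_rev (μ : ℂ) (s : ℕ) :
    (jordanBlock μ s).submatrix Fin.revPerm Fin.revPerm = (jordanBlock μ s)ᵀ := by
  ext i j
  simp only [jordanBlock, submatrix_apply, transpose_apply, of_apply, Fin.revPerm_apply,
    Fin.rev_inj, Fin.val_rev, eq_comm (a := j)]
  congr 2
  apply propext
  omega

theorem isTracePair_jordanBlock_self (μ : ℂ) (s : ℕ) :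
    IsTracePair (jordanBlock μ s) (jordanBlock μ s) := by
  have h : IsTracePair (jordanBlock μ s) (jordanBlock μ s)ᵀ :=
    ⟨jordanBlock μ s, 1, by simp⟩
  refine h.of_isSimilar_right ?_
  rw [← jordanBlock_submatrix_rev]
  exact (isSimilar_submatrix _ _).symm

theorem isTracePair_jordanBlock_succ (s : ℕ) :
    IsTracePair (jordanBlock 0 (s + 1)) (jordanBlock 0 s) := by
  have h : IsTracePair (jordanBlock 0 (s + 1)) (jordanBlock 0 s)ᵀ := by
    -- `X` includes `ℂ ^ s` as the first `s` coordinates and `Z` drops the first of `s + 1`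
    -- coordinates; either composite is a nilpotent shift.
    refine ⟨of fun i j => if i = j.castSucc then 1 else 0,
      of fun i j => if i.succ = j then 1 else 0, ?_, ?_⟩
    · ext i j
      rw [mul_apply]
      induction i using Fin.lastCases with
      | last =>
        have hj : ¬ (s + 1 = j.val) := by omega
        have hl : ∀ x : Fin s, ¬ (Fin.last s = x.castSucc) := fun x => (Fin.castSucc_ne_last x).symm
        simp [jordanBlock, hj, hl]
      | cast i =>
        rw [Finset.sum_eq_single i]
        · simp only [of_apply, if_true, one_mul, jordanBlock, Fin.ext_iff, Fin.val_succ,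
            Fin.val_castSucc]
          split_ifs <;> first | rfl | omega
        · intro x _ hx
          simp [hx.symm]
        · simp
    · ext i j
      rw [mul_apply, Finset.sum_eq_single i.castSucc]
      · simp only [transpose_apply, of_apply, if_true, one_mul, jordanBlock, Fin.ext_iff,
          Fin.val_succ, Fin.val_castSucc]
        split_ifs <;> first | rfl | omega
      · intro x _ hx
        simp [hx]
      · simp
  refine h.of_isSimilar_right ?_
  rw [← jordanBlock_submatrix_rev]
  exact (isSimilar_submatrix _ _).symm

theorem isTracePair_jordanBlock_zero {s t : ℕ} (h : |(s : ℤ) - t| ≤ 1) :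
    IsTracePair (jordanBlock 0 s) (jordanBlock 0 t) := by
  rw [abs_le] at h
  obtain rfl | rfl | rfl : s = t ∨ s = t + 1 ∨ t = s + 1 := by omega
  · exact isTracePair_jordanBlock_self 0 s
  · exact isTracePair_jordanBlock_succ t
  · exact (isTracePair_jordanBlock_succ s).symm

theorem IsTracePair.jordanMatrix_cons {a b : ℂ × ℕ} {L L' : List (ℂ × ℕ)}
    (h : IsTracePair (jordanBlock a.1 a.2) (jordanBlock b.1 b.2))
    (h' : IsTracePair (jordanMatrix L) (jordanMatrix L')) :
    IsTracePair (jordanMatrix (a :: L)) (jordanMatrix (b :: L')) :=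
  ((h.fromBlocks h').of_isSimilar_left (isSimilar_jordanMatrix_cons a L)).of_isSimilar_right
    (isSimilar_jordanMatrix_cons b L')

theorem isTracePair_jordanMatrix_self (L : List (ℂ × ℕ)) :
    IsTracePair (jordanMatrix L) (jordanMatrix L) := by
  induction L with
  | nil => exact ⟨0, 0, by ext q; exact q.1.elim0, by ext q; exact q.1.elim0⟩
  | cons a L ih => exact (isTracePair_jordanBlock_self a.1 a.2).jordanMatrix_cons ih

/-- A block of size zero has no indices, so the shorter list of nilpotent blocks may be padded. -/
theorem isSimilar_jordanMatrix_cons_zero (L : List (ℂ × ℕ)) :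
    IsSimilar (jordanMatrix L) (jordanMatrix ((0, 0) :: L)) :=
  ((isSimilar_jordanMatrix_cons (0, 0) L).trans (isSimilar_fromBlocks_of_isEmpty _ _)).symm

/-- Nilpotent Jordan matrices whose block sizes, listed in any order and padded with zeros, differ
by at most one in every place. -/
theorem isTracePair_jordanMatrix_zero (a b : List ℕ)
    (h : ∀ i, |(a.getD i 0 : ℤ) - (b.getD i 0 : ℤ)| ≤ 1) :
    IsTracePair (jordanMatrix (a.map fun s => (0, s))) (jordanMatrix (b.map fun s => (0, s))) := by
  have step : ∀ (s t : ℕ) {L L' : List (ℂ × ℕ)}, |(s : ℤ) - (t : ℤ)| ≤ 1 →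
      IsTracePair (jordanMatrix L) (jordanMatrix L') →
      IsTracePair (jordanMatrix ((0, s) :: L)) (jordanMatrix ((0, t) :: L')) :=
    fun s t _ _ hst hL =>
      (isTracePair_jordanBlock_zero hst).jordanMatrix_cons (a := (0, s)) (b := (0, t)) hL
  induction a generalizing b with
  | nil =>
    induction b with
    | nil => exact isTracePair_jordanMatrix_self []
    | cons t b ih =>
      exact (step 0 t (h 0) (ih fun i => h (i + 1))).of_isSimilar_left
        (isSimilar_jordanMatrix_cons_zero [])
  | cons s a ih =>
    cases b with
    | nil =>
      exact (step s 0 (h 0) (ih [] fun i => h (i + 1))).of_isSimilar_right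
        (isSimilar_jordanMatrix_cons_zero [])
    | cons t b => exact step s t (h 0) (ih b fun i => h (i + 1))

/-- A list of Jordan blocks, with the nilpotent ones moved to the end and sorted by size. -/
theorem perm_filter_ne_append_sorted (L : List (ℂ × ℕ)) :
    L.Perm ((L.filter fun b => b.1 ≠ 0) ++
      (((L.filter fun b => b.1 = 0).map Prod.snd).insertionSort (· ≥ ·)).map fun s => (0, s)) := by
  have h₀ : ((L.filter fun b => b.1 = 0).map Prod.snd).map (fun s => ((0 : ℂ), s)) =
      L.filter fun b => b.1 = 0 := by
    rw [List.map_map]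
    refine (List.map_congr_left fun b hb => ?_).trans (List.map_id _)
    have hb' : b.1 = 0 := by simpa using (List.mem_filter.mp hb).2
    simp [← hb']
  have h₁ := ((List.perm_insertionSort (· ≥ ·) ((L.filter fun b => b.1 = 0).map Prod.snd)).map
    (fun s => ((0 : ℂ), s))).symm
  rw [h₀] at h₁
  refine List.Perm.trans ?_ (h₁.append_left _)
  have h₂ := List.filter_append_perm (fun b : ℂ × ℕ => decide (b.1 ≠ 0)) L
  simpa using h₂.symm

/-- Blocks at nonzero eigenvalues pair with their equals; nilpotent blocks pair by position in the
sorted lists. -/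
theorem FlandersSimilar.isTracePair [DecidableEq m] [DecidableEq n] {A : Matrix m m ℂ}
    {B : Matrix n n ℂ} (h : FlandersSimilar A B) : IsTracePair A B := by
  obtain ⟨LA, LB, ⟨-, hA⟩, ⟨-, hB⟩, hne, hz⟩ := h
  have hne' := (isTracePair_jordanMatrix_self (LA.filter fun b => b.1 ≠ 0)).of_isSimilar_right
    (isSimilar_jordanMatrix_of_perm hne.symm)
  have key := hne'.fromBlocks (isTracePair_jordanMatrix_zero _ _ hz)
  have hs : ∀ L : List (ℂ × ℕ), IsSimilar (jordanMatrix L) _ := fun L =>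
    (isSimilar_jordanMatrix_of_perm (perm_filter_ne_append_sorted L)).trans
      (isSimilar_jordanMatrix_append _ _)
  exact ((key.of_isSimilar_left (hs LA)).of_isSimilar_right (hs LB)).of_isSimilar_left hA
    |>.of_isSimilar_right hB

end TracePair

/-! ### Rank-one matrices and their reshapings -/

section RankOne

theorem single_one_ne_zero {m n : Type*} [DecidableEq m] [DecidableEq n] (i : m) (j : n) :
    single i j (1 : ℂ) ≠ 0 := fun h => by
  simpa using congrFun (congrFun h i) j

variable {m n : Type*} [Fintype m] [Fintype n]

theorem exists_rank_one_of_mul {X : Matrix m n ℂ} {Z : Matrix n m ℂ} (hX : X ≠ 0) (hZ : Z ≠ 0) :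
    ∃ M : Matrix (m × n) (m × n) ℂ, M.rank = 1 ∧ trA M = Xᵀ * Zᵀ ∧ trB M = X * Z := by
  refine ⟨vecMulVec (fun p => X p.1 p.2) (fun q => Z q.2 q.1), rank_vecMulVec_eq_one ?_ ?_, ?_, ?_⟩
  · exact fun h => hX (ext fun i j => congrFun h (i, j))
  · exact fun h => hZ (ext fun i j => congrFun h (j, i))
  · ext i j
    simp [trA, mul_apply, vecMulVec_apply]
  · ext i j
    simp [trB, mul_apply, vecMulVec_apply]

theorem exists_mul_eq_trB_of_rank_eq_one {M : Matrix (m × n) (m × n) ℂ} (hM : M.rank = 1) :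
    ∃ (X : Matrix m n ℂ) (Z : Matrix n m ℂ), X * Z = trB M := by
  obtain ⟨x, y, rfl⟩ := (rank_le_iff_exists_mul M 1).mp hM.le
  refine ⟨of fun i k => x (i, k) 0, of fun k j => y 0 (j, k), ?_⟩
  ext i j
  simp [trB, mul_apply]

end RankOne

end PartialTrace

theorem mainTheorem7 (dA dB : ℕ) (hdA : 1 ≤ dA) (hdB : 1 ≤ dB) :
    (∀ (A : Matrix (Fin dA) (Fin dA) ℂ) (B : Matrix (Fin dB) (Fin dB) ℂ),
      PartialTrace.FlandersSimilar A B →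
      (A ≠ 0 ∨ B ≠ 0 ∨ (2 ≤ dA ∧ 2 ≤ dB)) →
      ∃ M : Matrix (Fin dA × Fin dB) (Fin dA × Fin dB) ℂ,
        M.rank = 1 ∧ PartialTrace.trA M = B ∧ PartialTrace.trB M = A) ∧
    (∀ (A : Matrix (Fin dA) (Fin dA) ℂ) (r : ℕ),
      A.rank = r →
      (A ≠ 0 ∨ 2 ≤ dB) →
      ((∃ M : Matrix (Fin dA × Fin dB) (Fin dA × Fin dB) ℂ,
        M.rank = 1 ∧ PartialTrace.trB M = A) ↔ r ≤ dB)) := by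
  open PartialTrace Matrix in
  refine ⟨fun A B hAB hne => ?_, fun A r hr hne => ⟨?_, fun hle => ?_⟩⟩
  · by_cases h0 : A = 0 ∧ B = 0
    · obtain ⟨rfl, rfl⟩ := h0
      obtain ⟨hA, hB⟩ : 2 ≤ dA ∧ 2 ≤ dB := by simpa using hne
      have hA' : (⟨0, hdA⟩ : Fin dA) ≠ ⟨1, hA⟩ := by simp
      have hB' : (⟨0, hdB⟩ : Fin dB) ≠ ⟨1, hB⟩ := by simp
      -- The units `E₀₀` and `E₁₁` are nonzero, yet both of their products vanish.
      obtain ⟨M, hM, hMA, hMB⟩ := exists_rank_one_of_mul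
        (X := single (⟨0, hdA⟩ : Fin dA) (⟨0, hdB⟩ : Fin dB) (1 : ℂ))
        (Z := single (⟨1, hB⟩ : Fin dB) (⟨1, hA⟩ : Fin dA) (1 : ℂ))
        (single_one_ne_zero _ _) (single_one_ne_zero _ _)
      refine ⟨M, hM, hMA.trans ?_, hMB.trans ?_⟩
      · simp only [transpose_single]
        exact single_mul_single_of_ne _ _ _ _ hA' _
      · exact single_mul_single_of_ne _ _ _ _ hB' _
    · obtain ⟨X, Z, rfl, rfl⟩ := hAB.isTracePair
      refine exists_rank_one_of_mul ?_ ?_ <;> rintro rfl <;> simp at h0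
  · rintro ⟨M, hM, rfl⟩
    obtain ⟨X, Z, hXZ⟩ := exists_mul_eq_trB_of_rank_eq_one hM
    exact hr ▸ (rank_le_iff_exists_mul _ _).mpr ⟨X, Z, hXZ⟩
  · by_cases h0 : A = 0
    · subst h0
      have hB : 2 ≤ dB := by simpa using hne
      have hB' : (⟨0, hdB⟩ : Fin dB) ≠ ⟨1, hB⟩ := by simp
      -- Only `X * Z` must vanish here, so distinct indices are needed only in `Fin dB`.
      obtain ⟨M, hM, -, hMB⟩ := exists_rank_one_of_mul
        (X := single (⟨0, hdA⟩ : Fin dA) (⟨0, hdB⟩ : Fin dB) (1 : ℂ))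
        (Z := single (⟨1, hB⟩ : Fin dB) (⟨0, hdA⟩ : Fin dA) (1 : ℂ))
        (single_one_ne_zero _ _) (single_one_ne_zero _ _)
      exact ⟨M, hM, hMB.trans (single_mul_single_of_ne _ _ _ _ hB' _)⟩
    · obtain ⟨X, Z, rfl⟩ := (rank_le_iff_exists_mul A dB).mp (hr.le.trans hle)
      obtain ⟨M, hM, -, hMB⟩ := exists_rank_one_of_mul (X := X) (Z := Z)
        (by rintro rfl; simp at h0) (by rintro rfl; simp at h0)
      exact ⟨M, hM, hMB⟩
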